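/- Let $p\ge 3$ be a prime number and let $\overline{\mathbb Q}_p$ be an algebraic closure of $\mathbb Q_p$, with the $p$-adic valuation $v_p$ normalized by $v_p(p)=1$. Fix a compatible system of rational powers of $p$ in $\overline{\mathbb Q}_p$, that is, elements $p^x\in\overline{\mathbb Q}_p$ $(x\in\mathbb Q)$ with $p^{x+y}=p^xp^y$, $p^0=1$, whose value at $x=1$ is $p$. Let $\zeta_{p^2}$ be a primitive $p^2$-th root of unity and $\zeta_{2(p-1)}$ a primitive $2(p-1)$-th root of unity in $\overline{\mathbb Q}_p$, chosen compatibly, i.e. $$v_p\Big(\zeta_{p^2}-1-\zeta_{2(p-1)}\,p^{\frac1{p(p-1)}}\Big)>\frac1{p(p-1)}.$$ For $0\le k\le p-1$ let $[k!]\in\mathbb Z_p$ be the Teichmüller representative of the class of $k!$ in $\mathbb F_p$, and for $m\ge 1$ let $K_{2,m}=\mathbb Q_p(\zeta_{p^2},p^{1/p^m})$. (A uniformizer of $K_{2,m}$ is an element of $K_{2,m}$ of positive valuation whose valuation generates the value group of $K_{2,m}$, which is discrete.) 1. The element $$\pi_{2,1}=\left(p^{\frac1p}\right)^{-1}\left(\zeta_{p^2}-\sum_{k=0}^{p-1}\frac{1}{[k!]}\zeta_{2(p-1)}^k\,p^{\frac{k}{p(p-1)}}\right)$$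 lies in $K_{2,1}$ and is a uniformizer of $K_{2,1}$, and $v_p(\pi_{2,1})=\frac{1}{p^2(p-1)}$. 2. For every $m\ge 2$, the element $$\pi_{2,m}=\left(p^{\frac1{p^m}}\right)^{-\frac{p^m-1}{p-1}}\left(\zeta_{p^2}-\sum_{k=0}^{p-1}\frac{1}{[k!]}\zeta_{2(p-1)}^k\,p^{\frac{k}{p(p-1)}}-\sum_{l=2}^{m}\zeta_{2(p-1)}\,p^{\frac1{p-1}-\frac1{p^l}}\right)$$ lies in $K_{2,m}$ and is a uniformizer of $K_{2,m}$, and $v_p(\pi_{2,m})=\frac{1}{p^{m+1}(p-1)}$. -/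

import Mathlib

open scoped NNReal Nat

noncomputable section

namespace FalseTate

variable {p : ℕ} [Fact p.Prime]

/-- The Teichmüller representative `[a] ∈ W(𝔽_p) = ℤ_p` of `a ∈ 𝔽_p`, seen in the algebraic
closure of `ℚ_p`. -/
def teich (a : ZMod p) : PadicAlgCl p :=
  algebraMap ℚ_[p] (PadicAlgCl p)
    ((WittVector.equiv p (WittVector.teichmuller p a) : ℤ_[p]) : ℚ_[p])

/-- The field `K_{2,m} = ℚ_p(ζ_{p²}, p^{1/p^m})`, where `ζ = ζ_{p²}` and `P x = p^x`. -/
def K2 (P : AddChar ℚ (PadicAlgCl p)) (ζ : PadicAlgCl p) (m : ℕ) :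
    IntermediateField ℚ_[p] (PadicAlgCl p) :=
  IntermediateField.adjoin ℚ_[p] {ζ, P (1 / (p : ℚ) ^ m)}

/-- The restriction to `K` of the (multiplicatively written) `p`-adic valuation of the algebraic
closure of `ℚ_p`. -/
def valuationOn (K : IntermediateField ℚ_[p] (PadicAlgCl p)) : Valuation K ℝ≥0 :=
  (Valued.v : Valuation (PadicAlgCl p) ℝ≥0).comap (algebraMap K (PadicAlgCl p))

/-- `π` is a uniformizer of `K`: the `p`-adic valuation is discrete on `K`, the element `π` lies
in `K`, and its valuation generates the value group of `K` and is `< 1`. -/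
def IsUniformizerOf (K : IntermediateField ℚ_[p] (PadicAlgCl p)) (π : PadicAlgCl p) : Prop :=
  ∃ (_ : (valuationOn K).IsRankOneDiscrete) (hπ : π ∈ K),
    (valuationOn K).IsUniformizer ⟨π, hπ⟩

/-- The sum `∑_{k=0}^{p-1} (1/[k!]) z^k p^{k/(p(p-1))}`, where `z = ζ_{2(p-1)}`
and `P x = p^x`. -/
def headSum (P : AddChar ℚ (PadicAlgCl p)) (z : PadicAlgCl p) : PadicAlgCl p :=
  ∑ k ∈ Finset.range p,
    1 / teich ((k ! : ℕ) : ZMod p) * z ^ k * P ((k : ℚ) / ((p : ℚ) * ((p : ℚ) - 1)))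

/-- `π_{2,1} = (p^{1/p})⁻¹ (ζ_{p²} - ∑_{k=0}^{p-1} (1/[k!]) z^k p^{k/(p(p-1))})`. -/
def pi21 (P : AddChar ℚ (PadicAlgCl p)) (ζ z : PadicAlgCl p) : PadicAlgCl p :=
  (P (1 / (p : ℚ)))⁻¹ * (ζ - headSum P z)

/-- `π_{2,m} = (p^{1/p^m})^{-(p^m-1)/(p-1)} (ζ_{p²} - ∑_{k=0}^{p-1} (1/[k!]) z^k p^{k/(p(p-1))}
- ∑_{l=2}^m z p^{1/(p-1) - 1/p^l})`. The division of natural numbers in the exponent is exact. -/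
def pi2 (P : AddChar ℚ (PadicAlgCl p)) (ζ z : PadicAlgCl p) (m : ℕ) : PadicAlgCl p :=
  (P (1 / (p : ℚ) ^ m) ^ ((p ^ m - 1) / (p - 1)))⁻¹ *
    (ζ - headSum P z -
      ∑ l ∈ Finset.Icc 2 m, z * P (1 / ((p : ℚ) - 1) - 1 / (p : ℚ) ^ l))

end FalseTate

end

noncomputable section

namespace FalseTate

variable {p : ℕ} [Fact p.Prime]

/-! ### The truncated exponential over `ℤ_p` and its `p`-th power. -/

section TruncExp

open Polynomial

/-! Put `a = z p^{1/(p(p-1))}`, `b = -z p^{1/(p-1)}`, `s_l = z p^{1/(p-1) - 1/p^l}`. Since `z^(p-1)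
= -1`, one has `a^p = b`, `b^(p-1) = -p`, `s_1 = a` and `s_{l+1}^p = -p s_l`.

Let `E` be the exponential truncated at degree `p`. Modulo terms of norm at most `|p||b|`, `ζ^p` is
`E(b)` (`norm_sub_truncExp_le`) and `E(a)^p` is `E(b) + pa` (`norm_truncExp_root_pow_le`). Hence `x
= ζ - E(a)` satisfies `x^p + px + pa ≈ 0` (`norm_error_equation`). The dominant balance `x^p ≈ -pa =
s_2^p` gives `|x| = |s_2|`, and subtracting `s_2` reproduces the equation with `s_2` in place of
`a`. By induction the remainder after subtracting `s_2, …, s_m` has norm `|s_{m+1}|`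
(`norm_error_sub_sum`). Replacing `1/k!` by `1/[k!]` costs at most `|p| ≤ |b| < |s_{m+1}|`. This
gives the valuation of `π_{2,m}` (`norm_pi2`).

Krasner's lemma puts `a`, hence every `s_l` with `l ≤ m`, in `K_{2,m}` (`tailTerm_mem_K2`). The
degree of `K_{2,m}` is at most `N = p^(m+1)(p-1)`, while `|π|^N = |p|`; so the powers of `π` below
`N` form a basis whose terms have distinct norms, and `|π|` generates the value group
(`isUniformizerOf_of_finrank_le`). -/

theorem isUnit_factorial_padicInt {k : ℕ} (hk : k < p) : IsUnit ((k ! : ℕ) : ℤ_[p]) := by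
  have hp : p.Prime := Fact.out
  rw [PadicInt.isUnit_iff, PadicInt.norm_def, PadicInt.coe_natCast, Padic.norm_natCast_eq_one_iff]
  exact hp.coprime_factorial_of_lt hk

/-- If `p` divides all coefficients of the reduction, Frobenius lifts: `f^p = f(X^p)` mod `p`. -/
theorem C_dvd_pow_sub_expand (f : ℤ_[p][X]) :
    C (p : ℤ_[p]) ∣ f ^ p - expand ℤ_[p] p f := by
  rw [C_dvd_iff_dvd_coeff]
  intro n
  rw [← Ideal.mem_span_singleton, ← PadicInt.maximalIdeal_eq_span_p, ← PadicInt.ker_toZMod,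
    RingHom.mem_ker, ← coeff_map, Polynomial.map_sub, Polynomial.map_pow, map_expand,
    ZMod.expand_card, sub_self, coeff_zero]

/-- The truncated exponential `T = ∑_{k<p} X^k/k!` has `p`-integral coefficients, and
`T(X)^p = T(X^p) + p R(X)` where `R ≡ X` modulo `(p X^2, X^p)`. -/
theorem exists_truncExp (p : ℕ) [hpf : Fact p.Prime] :
    ∃ T R : ℤ_[p][X], (∀ k < p, ((k ! : ℕ) : ℤ_[p]) * T.coeff k = 1) ∧
      (∀ k, p ≤ k → T.coeff k = 0) ∧ T ^ p = expand ℤ_[p] p T + C (p : ℤ_[p]) * R ∧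
      R.coeff 0 = 0 ∧ R.coeff 1 = 1 ∧ ∀ n, 2 ≤ n → n < p → (p : ℤ_[p]) ∣ R.coeff n := by
  have hp : p.Prime := hpf.out
  have hp0 : (p : ℤ_[p]) ≠ 0 := by exact_mod_cast hp.ne_zero
  let c : ℕ → ℤ_[p] := fun k => Ring.inverse ((k ! : ℕ) : ℤ_[p])
  have hc : ∀ k < p, ((k ! : ℕ) : ℤ_[p]) * c k = 1 := fun k hk =>
    Ring.mul_inverse_cancel _ (isUnit_factorial_padicInt hk)
  let T : ℤ_[p][X] := ∑ k ∈ Finset.range p, monomial k (c k)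
  have hT : ∀ n, T.coeff n = if n < p then c n else 0 := by
    intro n
    simp [T, coeff_monomial]
  have hT1 : ∀ k < p, ((k ! : ℕ) : ℤ_[p]) * T.coeff k = 1 := by
    intro k hk
    rw [hT, if_pos hk, hc k hk]
  have hTq : T.map PadicInt.Coe.ringHom = PowerSeries.trunc p (PowerSeries.exp ℚ_[p]) := by
    ext n
    rw [coeff_map, PowerSeries.coeff_trunc]
    split_ifs with h
    · have h1 := congrArg PadicInt.Coe.ringHom (hT1 n h)
      rw [map_mul, map_natCast, map_one] at h1
      rw [PowerSeries.coeff_exp, eq_comm]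
      simpa using (eq_inv_of_mul_eq_one_right h1).symm
    · rw [hT, if_neg h, map_zero]
  -- Truncation does not affect degrees below `p`, where `T^p` agrees with `exp(X)^p = exp(pX)`.
  have hpow : ∀ n < p, ((n ! : ℕ) : ℤ_[p]) * (T ^ p).coeff n = (p : ℤ_[p]) ^ n := by
    intro n hn
    have h1 := congrArg (fun f : ℚ_[p][X] => f.coeff n)
      (PowerSeries.trunc_trunc_pow (PowerSeries.exp ℚ_[p]) p p)
    simp only [PowerSeries.coeff_trunc, if_pos hn] at h1
    rw [← hTq, ← Polynomial.coe_pow, Polynomial.coeff_coe, ← Polynomial.map_pow, coeff_map,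
      PowerSeries.exp_pow_eq_rescale_exp, PowerSeries.coeff_rescale, PowerSeries.coeff_exp] at h1
    have hn0 : ((n ! : ℕ) : ℚ_[p]) ≠ 0 := by exact_mod_cast n.factorial_ne_zero
    have h2 : PadicInt.Coe.ringHom (((n ! : ℕ) : ℤ_[p]) * (T ^ p).coeff n) =
        PadicInt.Coe.ringHom ((p : ℤ_[p]) ^ n) := by
      rw [map_mul, h1, map_natCast, map_pow, map_natCast]
      simp only [one_div, map_inv₀, map_natCast]
      field_simp
    exact Subtype.ext h2
  obtain ⟨R, hR⟩ := C_dvd_pow_sub_expand T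
  have hTR : T ^ p = expand ℤ_[p] p T + C (p : ℤ_[p]) * R := by rw [← hR]; ring
  -- `T(X^p)` has no terms in degrees `1, …, p-1`, so there `pR` carries all of `exp(pX)`.
  have hRn : ∀ n, 1 ≤ n → n < p → ((n ! : ℕ) : ℤ_[p]) * R.coeff n = (p : ℤ_[p]) ^ (n - 1) := by
    intro n h1 hn
    have h2 := hpow n hn
    rw [hTR, coeff_add, coeff_C_mul, coeff_expand hp.pos,
      if_neg (fun h => absurd (Nat.le_of_dvd h1 h) (by omega)), zero_add] at h2
    apply mul_left_cancel₀ hp0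
    rw [← pow_succ', Nat.sub_add_cancel h1, ← h2]
    ring
  refine ⟨T, R, hT1, fun k hk => by rw [hT, if_neg (by omega)], hTR, ?_, ?_, ?_⟩
  · have h2 := hpow 0 hp.pos
    have h3 := hT1 0 hp.pos
    rw [hTR, coeff_add, coeff_C_mul, coeff_expand hp.pos, if_pos (dvd_zero p), Nat.zero_div,
      mul_add, h3] at h2
    simpa [hp0] using h2
  · simpa using hRn 1 le_rfl hp.one_lt
  · intro n h2 hn
    have h3 := hRn n (by omega) hn
    have h4 : (p : ℤ_[p]) ∣ ((n ! : ℕ) : ℤ_[p]) * R.coeff n := by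
      rw [h3]; exact dvd_pow_self _ (by omega)
    exact (isUnit_factorial_padicInt hn).dvd_mul_left.mp h4

end TruncExp

/-! ### Ultrametric estimates for `p`-th powers of sums. -/

section Ultrametric

variable {L : Type*} [NormedField L] [IsUltrametricDist L]

theorem norm_add_le_of_le_of_le {x y : L} {C : ℝ} (hx : ‖x‖ ≤ C) (hy : ‖y‖ ≤ C) :
    ‖x + y‖ ≤ C :=
  (IsUltrametricDist.norm_add_le_max x y).trans (max_le hx hy)

theorem norm_sub_le_of_le_of_le {x y : L} {C : ℝ} (hx : ‖x‖ ≤ C) (hy : ‖y‖ ≤ C) :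
    ‖x - y‖ ≤ C := by
  rw [sub_eq_add_neg]
  exact norm_add_le_of_le_of_le hx (by rwa [norm_neg])

theorem norm_add_lt_of_lt_of_lt {x y : L} {C : ℝ} (hx : ‖x‖ < C) (hy : ‖y‖ < C) :
    ‖x + y‖ < C :=
  (IsUltrametricDist.norm_add_le_max x y).trans_lt (max_lt hx hy)

theorem norm_sub_lt_of_lt_of_lt {x y : L} {C : ℝ} (hx : ‖x‖ < C) (hy : ‖y‖ < C) :
    ‖x - y‖ < C := by
  rw [sub_eq_add_neg]
  exact norm_add_lt_of_lt_of_lt hx (by rwa [norm_neg])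

theorem norm_eq_of_norm_sub_lt {x y : L} (h : ‖x - y‖ < ‖y‖) : ‖x‖ = ‖y‖ := by
  have h1 := IsUltrametricDist.norm_add_eq_max_of_norm_ne_norm (x := x - y) (y := y) h.ne
  rwa [sub_add_cancel, max_eq_right h.le] at h1

theorem norm_natCast_le_one' (n : ℕ) : ‖(n : L)‖ ≤ 1 :=
  IsUltrametricDist.norm_natCast_le_one L n

theorem norm_choose_le {q i : ℕ} (hq : q.Prime) (h0 : i ≠ 0) (hi : i < q) :
    ‖(q.choose i : L)‖ ≤ ‖(q : L)‖ := by
  obtain ⟨c, hc⟩ := hq.dvd_choose_self h0 hi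
  rw [hc, Nat.cast_mul, norm_mul]
  exact mul_le_of_le_one_right (norm_nonneg _) (norm_natCast_le_one' c)

/-- Every middle binomial coefficient is divisible by `q`, and every middle monomial by `xy`. -/
theorem norm_add_pow_sub_le {q : ℕ} (hq : q.Prime) {x y : L} (hx : ‖x‖ ≤ 1) (hy : ‖y‖ ≤ 1) :
    ‖(x + y) ^ q - x ^ q - y ^ q‖ ≤ ‖(q : L)‖ * (‖x‖ * ‖y‖) := by
  have h : (x + y) ^ q - x ^ q - y ^ q =
      ∑ i ∈ Finset.Ico 1 q, x ^ i * y ^ (q - i) * (q.choose i : L) := by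
    rw [add_pow, Finset.sum_range_succ, Finset.range_eq_Ico, Finset.sum_eq_sum_Ico_succ_bot hq.pos]
    simp
  rw [h]
  refine IsUltrametricDist.norm_sum_le_of_forall_le_of_nonneg (by positivity) fun i hi => ?_
  rw [Finset.mem_Ico] at hi
  rw [norm_mul, norm_mul, norm_pow, norm_pow, mul_comm]
  gcongr
  · exact norm_choose_le hq (by omega) hi.2
  · exact pow_le_of_le_one (norm_nonneg _) hx (by omega)
  · exact pow_le_of_le_one (norm_nonneg _) hy (by omega)

theorem norm_add_pow_sub_sub_le {q : ℕ} (hq : q.Prime) (hq3 : 3 ≤ q) {x y : L}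
    (hx : ‖x‖ ≤ 1) (hy : ‖y‖ ≤ 1) :
    ‖(x + y) ^ q - x ^ q - y ^ q - (q : L) * x ^ (q - 1) * y‖ ≤ ‖(q : L)‖ * ‖y‖ ^ 2 := by
  have h : (x + y) ^ q - x ^ q - y ^ q - (q : L) * x ^ (q - 1) * y =
      ∑ i ∈ Finset.Ico 2 q, y ^ i * x ^ (q - i) * (q.choose i : L) := by
    rw [add_comm x y, add_pow, Finset.sum_range_succ, Finset.range_eq_Ico,
      Finset.sum_eq_sum_Ico_succ_bot hq.pos, Finset.sum_eq_sum_Ico_succ_bot (by omega)]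
    simp
    ring
  rw [h]
  refine IsUltrametricDist.norm_sum_le_of_forall_le_of_nonneg (by positivity) fun i hi => ?_
  rw [Finset.mem_Ico] at hi
  rw [norm_mul, norm_mul, norm_pow, norm_pow, mul_comm]
  gcongr
  · exact norm_choose_le hq (by omega) hi.2
  · rw [← mul_one (‖y‖ ^ 2)]
    exact mul_le_mul (pow_le_pow_of_le_one (norm_nonneg _) hy hi.1)
      (pow_le_one₀ (norm_nonneg _) hx) (by positivity) (by positivity)

theorem norm_eval₂_le {A : Type*} [CommRing A] (f : A →+* L) (F : Polynomial A) {x : L} {C : ℝ}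
    (hC : 0 ≤ C) (h : ∀ n, ‖f (F.coeff n)‖ * ‖x‖ ^ n ≤ C) : ‖F.eval₂ f x‖ ≤ C := by
  rw [Polynomial.eval₂_eq_sum_range]
  refine IsUltrametricDist.norm_sum_le_of_forall_le_of_nonneg hC fun n _ => ?_
  rw [norm_mul, norm_pow]
  exact h n

end Ultrametric

/-! ### Expansion of a `p²`-th root of unity around the truncated exponential. -/

section Expansion

theorem norm_p_eq : ‖(p : PadicAlgCl p)‖ = (p : ℝ)⁻¹ := by
  rw [← PadicAlgCl.valuation_coe, PadicAlgCl.valuation_p]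
  simp

theorem norm_p_pos : 0 < ‖(p : PadicAlgCl p)‖ :=
  norm_pos_iff.mpr (by exact_mod_cast (Fact.out : p.Prime).ne_zero)

theorem norm_p_lt_one : ‖(p : PadicAlgCl p)‖ < 1 := by
  rw [norm_p_eq]
  exact inv_lt_one_of_one_lt₀ (by exact_mod_cast (Fact.out : p.Prime).one_lt)

/-- The inclusion of `ℤ_p` in the algebraic closure of `ℚ_p`. -/
def intEmb : ℤ_[p] →+* PadicAlgCl p :=
  (algebraMap ℚ_[p] (PadicAlgCl p)).comp PadicInt.Coe.ringHom

theorem norm_intEmb (c : ℤ_[p]) : ‖intEmb c‖ = ‖c‖ :=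
  PadicAlgCl.norm_extends p (c : ℚ_[p])

theorem norm_intEmb_le_one (c : ℤ_[p]) : ‖intEmb c‖ ≤ 1 := by
  rw [norm_intEmb]
  exact PadicInt.norm_le_one c

theorem norm_intEmb_le_of_dvd {c d : ℤ_[p]} (h : c ∣ d) : ‖intEmb d‖ ≤ ‖intEmb c‖ := by
  obtain ⟨e, rfl⟩ := h
  rw [map_mul, norm_mul]
  exact mul_le_of_le_one_right (norm_nonneg _) (norm_intEmb_le_one e)

/-- The exponential series truncated at degree `p`. -/
def truncExp (x : PadicAlgCl p) : PadicAlgCl p :=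
  ∑ k ∈ Finset.range p, ((k ! : ℕ) : PadicAlgCl p)⁻¹ * x ^ k

theorem norm_factorial {k : ℕ} (hk : k < p) : ‖((k ! : ℕ) : PadicAlgCl p)‖ = 1 := by
  rw [← map_natCast intEmb, norm_intEmb]
  exact PadicInt.isUnit_iff.mp (isUnit_factorial_padicInt hk)

theorem norm_truncExp_sub_le (hp : 3 ≤ p) {x : PadicAlgCl p} (hx : ‖x‖ ≤ 1) :
    ‖truncExp x - 1 - x‖ ≤ ‖x‖ ^ 2 := by
  have h : truncExp x - 1 - x =
      ∑ k ∈ Finset.Ico 2 p, ((k ! : ℕ) : PadicAlgCl p)⁻¹ * x ^ k := by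
    rw [truncExp, Finset.range_eq_Ico, Finset.sum_eq_sum_Ico_succ_bot (by omega),
      Finset.sum_eq_sum_Ico_succ_bot (by omega)]
    simp
  rw [h]
  refine IsUltrametricDist.norm_sum_le_of_forall_le_of_nonneg (by positivity) fun k hk => ?_
  rw [Finset.mem_Ico] at hk
  rw [norm_mul, norm_inv, norm_factorial hk.2, inv_one, one_mul, norm_pow]
  exact pow_le_pow_of_le_one (norm_nonneg _) hx hk.1

/-- `exp(x)^p = exp(px)`, for the truncated exponential. -/
theorem truncExp_pow (hp : 3 ≤ p) {x : PadicAlgCl p} (hx : ‖x‖ ≤ 1) :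
    ∃ y, truncExp x ^ p = truncExp (x ^ p) + p * y ∧
      ‖y - x‖ ≤ max (‖(p : PadicAlgCl p)‖ * ‖x‖ ^ 2) (‖x‖ ^ p) := by
  obtain ⟨T, R, hT, hT0, hTR, hR0, hR1, hR⟩ := exists_truncExp p
  have heval : ∀ w, T.eval₂ intEmb w = truncExp w := by
    intro w
    rw [Polynomial.eval₂_eq_sum_range' intEmb (n := p), truncExp]
    · refine Finset.sum_congr rfl fun k hk => ?_
      have h := congrArg intEmb (hT k (Finset.mem_range.mp hk))
      rw [map_mul, map_natCast, map_one] at h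
      rw [eq_inv_of_mul_eq_one_right h]
    · refine Nat.lt_of_le_pred (by omega) (Polynomial.natDegree_le_iff_coeff_eq_zero.mpr ?_)
      exact fun k hk => hT0 k (Nat.le_of_pred_lt hk)
  refine ⟨R.eval₂ intEmb x, ?_, ?_⟩
  · have h := congrArg (Polynomial.eval₂ intEmb x) hTR
    rwa [Polynomial.eval₂_pow, Polynomial.eval₂_add, Polynomial.eval₂_mul, Polynomial.eval₂_C,
      Polynomial.expand_eq_comp_X_pow, Polynomial.eval₂_comp, Polynomial.eval₂_pow,
      Polynomial.eval₂_X, heval, heval, map_natCast] at h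
  · have h : R.eval₂ intEmb x - x = (R - Polynomial.X).eval₂ intEmb x := by
      rw [Polynomial.eval₂_sub, Polynomial.eval₂_X]
    rw [h]
    refine norm_eval₂_le intEmb _ (by positivity) fun n => ?_
    rcases Nat.lt_or_ge n 2 with hn | hn
    · have h0 : (R - Polynomial.X).coeff n = 0 := by
        interval_cases n <;> simp [hR0, hR1]
      rw [h0, map_zero, norm_zero, zero_mul]
      positivity
    have hc : (R - Polynomial.X).coeff n = R.coeff n := by
      rw [Polynomial.coeff_sub, Polynomial.coeff_X, if_neg (by omega), sub_zero]
    rw [hc]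
    -- Coefficients in degrees `2, …, p-1` are divisible by `p`; those from degree `p` on are only
    -- integral. These give the two entries of the maximum.
    rcases Nat.lt_or_ge n p with hnp | hnp
    · refine le_max_of_le_left ?_
      have h1 := norm_intEmb_le_of_dvd (hR n hn hnp)
      rw [map_natCast] at h1
      exact mul_le_mul h1 (pow_le_pow_of_le_one (norm_nonneg _) hx hn) (by positivity)
        (norm_nonneg _)
    · refine le_max_of_le_right ?_
      rw [← one_mul (‖x‖ ^ p)]
      exact mul_le_mul (norm_intEmb_le_one _) (pow_le_pow_of_le_one (norm_nonneg _) hx hnp)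
        (by positivity) zero_le_one

variable {a b : PadicAlgCl p}

theorem norm_pow_sub_one_of_pow_eq (hb : b ^ (p - 1) = -p) :
    ‖b‖ ^ (p - 1) = ‖(p : PadicAlgCl p)‖ := by
  rw [← norm_pow, hb, norm_neg]

theorem norm_lt_one_of_pow_eq (hb : b ^ (p - 1) = -p) : ‖b‖ < 1 := by
  have h := norm_pow_sub_one_of_pow_eq hb
  by_contra! h1
  exact absurd norm_p_lt_one (not_lt.mpr (h ▸ one_le_pow₀ h1))

theorem norm_pos_of_pow_eq (hp : 3 ≤ p) (hb : b ^ (p - 1) = -p) : 0 < ‖b‖ := by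
  rw [norm_pos_iff]
  rintro rfl
  have h := norm_p_pos (p := p)
  rw [← norm_neg, ← hb, zero_pow (by omega), norm_zero] at h
  exact h.false

theorem norm_p_le (hp : 3 ≤ p) (hb : b ^ (p - 1) = -p) :
    ‖(p : PadicAlgCl p)‖ ≤ ‖b‖ := by
  rw [← norm_pow_sub_one_of_pow_eq hb]
  exact pow_le_of_le_one (norm_nonneg _) (norm_lt_one_of_pow_eq hb).le (by omega)

theorem norm_pow_p_eq (hb : b ^ (p - 1) = -p) : ‖b‖ ^ p = ‖(p : PadicAlgCl p)‖ * ‖b‖ := by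
  rw [← norm_pow_sub_one_of_pow_eq hb, ← pow_succ,
    Nat.sub_add_cancel (Fact.out : p.Prime).one_le]

theorem pow_p_eq (hb : b ^ (p - 1) = -p) : b ^ p = -(p * b) := by
  rw [← pow_sub_one_mul (Fact.out : p.Prime).ne_zero, hb, neg_mul]

theorem norm_root_lt_one (hab : a ^ p = b) (hb : b ^ (p - 1) = -p) : ‖a‖ < 1 := by
  by_contra! h1
  have h := norm_lt_one_of_pow_eq hb
  rw [← hab, norm_pow] at h
  exact absurd h (not_lt.mpr (one_le_pow₀ h1))

theorem norm_truncExp_root_pow_le (hp : 3 ≤ p) (hab : a ^ p = b) (hb : b ^ (p - 1) = -p) :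
    ‖truncExp a ^ p - truncExp b - p * a‖ ≤ ‖(p : PadicAlgCl p)‖ * ‖b‖ := by
  have ha := norm_root_lt_one hab hb
  obtain ⟨y, hy, hya⟩ := truncExp_pow hp ha.le
  rw [hy, hab, show truncExp b + p * y - truncExp b - p * a = p * (y - a) by ring, norm_mul]
  gcongr
  refine hya.trans (max_le ?_ ?_)
  · exact (mul_le_of_le_one_right (norm_nonneg _) (pow_le_one₀ (norm_nonneg _) ha.le)).trans
      (norm_p_le hp hb)
  · rw [← norm_pow, hab]

/-- The linear term `b^p` of `E(b^p)` cancels `pb`, because `b^p = -pb`. What remains is of second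
order in `p`. -/
theorem norm_truncExp_pow_sub_one_le (hp : 3 ≤ p) (hb : b ^ (p - 1) = -p) :
    ‖truncExp b ^ p - 1‖ ≤ ‖(p : PadicAlgCl p)‖ ^ 2 * ‖b‖ := by
  have hb1 := norm_lt_one_of_pow_eq hb
  have hpb := norm_pow_p_eq hb
  obtain ⟨y, hy, hyb⟩ := truncExp_pow hp hb1.le
  have h : truncExp b ^ p - 1 = (truncExp (b ^ p) - 1 - b ^ p) + p * (y - b) := by
    rw [hy, pow_p_eq hb]; ring
  rw [h]
  refine norm_add_le_of_le_of_le ?_ ?_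
  · refine (norm_truncExp_sub_le hp ?_).trans ?_
    · rw [norm_pow]
      exact pow_le_one₀ (norm_nonneg _) hb1.le
    · rw [norm_pow, hpb, mul_pow]
      gcongr
      exact pow_le_of_le_one (norm_nonneg _) hb1.le two_ne_zero
  · rw [norm_mul, sq, mul_assoc]
    gcongr
    refine hyb.trans (max_le ?_ hpb.le)
    gcongr
    exact pow_le_of_le_one (norm_nonneg _) hb1.le two_ne_zero

/-- A `p`-th root of unity close to `1 + b`, where `b^(p-1) = -p`, is close to `exp b`. -/
theorem norm_sub_truncExp_le (hp : 3 ≤ p) (hb : b ^ (p - 1) = -p) {η : PadicAlgCl p}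
    (hη : η ^ p = 1) (hηb : ‖η - 1 - b‖ < ‖b‖) :
    ‖η - truncExp b‖ ≤ ‖(p : PadicAlgCl p)‖ * ‖b‖ := by
  have hprime : p.Prime := Fact.out
  have hb1 := norm_lt_one_of_pow_eq hb
  have hb0 := norm_pos_of_pow_eq hp hb
  have hη1 : ‖η‖ = 1 := by
    rw [← pow_eq_one_iff_of_nonneg (norm_nonneg η) hprime.ne_zero, ← norm_pow, hη, norm_one]
  set δ := truncExp b - η with hδ
  have hδb : ‖δ‖ < ‖b‖ := by
    rw [show δ = (truncExp b - 1 - b) - (η - 1 - b) by rw [hδ]; ring]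
    refine norm_sub_lt_of_lt_of_lt ((norm_truncExp_sub_le hp hb1.le).trans_lt ?_) hηb
    rw [sq]
    exact mul_lt_of_lt_one_left hb0 hb1
  rw [norm_sub_rev, ← hδ]
  rcases eq_or_ne δ 0 with h0 | h0
  · rw [h0, norm_zero]; positivity
  have hδ0 : 0 < ‖δ‖ := norm_pos_iff.mpr h0
  have hp0 := norm_p_pos (p := p)
  have h1 := norm_add_pow_sub_sub_le hprime hp hη1.le (hδb.trans hb1).le
  rw [show η + δ = truncExp b by rw [hδ]; ring, hη] at h1
  have hmain : ‖(p : PadicAlgCl p) * η ^ (p - 1) * δ‖ = ‖(p : PadicAlgCl p)‖ * ‖δ‖ := by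
    rw [norm_mul, norm_mul, norm_pow, hη1, one_pow, mul_one]
  -- In the expansion of `(η + δ)^p - η^p` the linear term dominates: `|δ| < |b|` makes `|δ|^p <
  -- |p||δ|`, as `|b|^(p-1) = |p|`. So `|p||δ| = |E(b)^p - 1|`.
  have hlt : ‖truncExp b ^ p - 1 - (p : PadicAlgCl p) * η ^ (p - 1) * δ‖ <
      ‖(p : PadicAlgCl p)‖ * ‖δ‖ := by
    rw [show truncExp b ^ p - 1 - (p : PadicAlgCl p) * η ^ (p - 1) * δ =
      (truncExp b ^ p - 1 - δ ^ p - (p : PadicAlgCl p) * η ^ (p - 1) * δ) + δ ^ p by ring]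
    refine norm_add_lt_of_lt_of_lt (h1.trans_lt ?_) ?_
    · rw [sq]
      gcongr
      exact mul_lt_of_lt_one_left hδ0 (hδb.trans hb1)
    · rw [norm_pow, ← norm_pow_sub_one_of_pow_eq hb, ← pow_sub_one_mul hprime.ne_zero]
      gcongr
      omega
  have heq := norm_eq_of_norm_sub_lt (hlt.trans_eq hmain.symm)
  have hle := norm_truncExp_pow_sub_one_le hp hb
  rw [heq, hmain, sq, mul_assoc] at hle
  exact le_of_mul_le_mul_left hle hp0

variable {ζ : PadicAlgCl p}

/-- Transfers the compatibility of `ζ` with `a` to that of `ζ^p` with `b`: the cross terms of the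
`p`-th power are at most `|p||a| < |b|`. -/
theorem norm_pow_sub_one_sub_lt (hp : 3 ≤ p) (hab : a ^ p = b) (hb : b ^ (p - 1) = -p)
    (hζa : ‖ζ - 1 - a‖ < ‖a‖) : ‖ζ ^ p - 1 - b‖ < ‖b‖ := by
  have hprime : p.Prime := Fact.out
  have ha1 := norm_root_lt_one hab hb
  have hb0 := norm_pos_of_pow_eq hp hb
  have hpb := norm_p_le hp hb
  have ha0 : 0 < ‖a‖ := (norm_nonneg _).trans_lt hζa
  have hpa : ‖(p : PadicAlgCl p)‖ * ‖a‖ < ‖b‖ :=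
    (mul_lt_of_lt_one_right norm_p_pos ha1).trans_le hpb
  set e := ζ - 1 - a with he
  have hae : ‖a + e‖ = ‖a‖ := norm_eq_of_norm_sub_lt (by rwa [add_sub_cancel_left])
  have h1 := norm_add_pow_sub_le (L := PadicAlgCl p) hprime (x := 1) (y := a + e) (by simp)
    (hae.trans_lt ha1).le
  have h2 := norm_add_pow_sub_le hprime ha1.le (hζa.trans ha1).le
  rw [show ζ ^ p - 1 - b = ((1 + (a + e)) ^ p - 1 ^ p - (a + e) ^ p) +
    ((a + e) ^ p - a ^ p - e ^ p) + e ^ p by rw [← hab, he]; ring]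
  refine norm_add_lt_of_lt_of_lt (norm_add_lt_of_lt_of_lt (h1.trans_lt ?_) (h2.trans_lt ?_)) ?_
  · rw [norm_one, one_mul, hae]
    exact hpa
  · refine lt_of_le_of_lt ?_ hpa
    gcongr
    exact mul_le_of_le_one_right ha0.le (hζa.trans ha1).le
  · rw [← hab, norm_pow, norm_pow]
    exact pow_lt_pow_left₀ hζa (norm_nonneg _) hprime.ne_zero

/-- The equation satisfied by the error term `x = ζ - exp a`. -/
theorem norm_error_equation (hp : 3 ≤ p) (hab : a ^ p = b) (hb : b ^ (p - 1) = -p)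
    (hζ : ζ ^ (p ^ 2) = 1) (hζa : ‖ζ - 1 - a‖ < ‖a‖) {x : PadicAlgCl p}
    (hx : x = ζ - truncExp a) :
    ‖x ^ p + p * x + p * a‖ ≤ ‖(p : PadicAlgCl p)‖ * ‖b‖ := by
  have hprime : p.Prime := Fact.out
  have ha1 := norm_root_lt_one hab hb
  have ha0 : 0 < ‖a‖ := (norm_nonneg _).trans_lt hζa
  have hb0 := norm_pos_of_pow_eq hp hb
  have hp0 := norm_p_pos (p := p)
  have habn : ‖a‖ ^ p = ‖b‖ := by rw [← norm_pow, hab]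
  have hxa : ‖x‖ < ‖a‖ := by
    rw [show x = (ζ - 1 - a) - (truncExp a - 1 - a) by rw [hx]; ring]
    refine norm_sub_lt_of_lt_of_lt hζa ((norm_truncExp_sub_le hp ha1.le).trans_lt ?_)
    rw [sq]
    exact mul_lt_of_lt_one_left ha0 ha1
  set t := truncExp a with ht
  have ht1 : ‖t - 1‖ ≤ ‖a‖ := by
    rw [show t - 1 = (t - 1 - a) + a by ring]
    refine norm_add_le_of_le_of_le ((norm_truncExp_sub_le hp ha1.le).trans ?_) le_rfl
    exact pow_le_of_le_one ha0.le ha1.le two_ne_zero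
  have htn : ‖t‖ ≤ 1 := by
    rw [show t = (t - 1) + 1 by ring]
    exact norm_add_le_of_le_of_le (ht1.trans ha1.le) (by simp)
  have htp : ‖t ^ (p - 1) - 1‖ ≤ ‖a‖ := by
    rw [← mul_geom_sum, norm_mul]
    refine (mul_le_of_le_one_right (norm_nonneg _) ?_).trans ht1
    refine IsUltrametricDist.norm_sum_le_of_forall_le_of_nonneg zero_le_one fun i _ => ?_
    rw [norm_pow]
    exact pow_le_one₀ (norm_nonneg _) htn
  have hζp : ‖ζ ^ p - t ^ p + p * a‖ ≤ ‖(p : PadicAlgCl p)‖ * ‖b‖ := by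
    rw [show ζ ^ p - t ^ p + p * a =
      (ζ ^ p - truncExp b) - (t ^ p - truncExp b - p * a) by ring]
    refine norm_sub_le_of_le_of_le (norm_sub_truncExp_le hp hb ?_
      (norm_pow_sub_one_sub_lt hp hab hb hζa)) (norm_truncExp_root_pow_le hp hab hb)
    rw [← pow_mul, ← sq, hζ]
  have hexp := norm_add_pow_sub_sub_le hprime hp htn (hxa.trans ha1).le
  rw [show t + x = ζ by rw [hx]; ring] at hexp
  have hba : ‖b‖ ≤ ‖a‖ := by
    rw [← habn]; exact pow_le_of_le_one ha0.le ha1.le hprime.ne_zero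
  -- A first bound on `x`, using only `|x| < |a|`. It yields `|a||x| ≤ |b|`, which then makes the
  -- cross terms small enough for the sharp estimate.
  have hcrude : ‖x ^ p‖ ≤ ‖(p : PadicAlgCl p)‖ * ‖a‖ := by
    rw [show x ^ p = (ζ ^ p - t ^ p + p * a) - p * a -
      (ζ ^ p - t ^ p - x ^ p - p * t ^ (p - 1) * x) - p * t ^ (p - 1) * x by ring]
    refine norm_sub_le_of_le_of_le (norm_sub_le_of_le_of_le (norm_sub_le_of_le_of_le
      (hζp.trans ?_) ?_) (hexp.trans ?_)) ?_
    · gcongr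
    · rw [norm_mul]
    · gcongr
      exact (pow_le_of_le_one (norm_nonneg _) (hxa.trans ha1).le two_ne_zero).trans hxa.le
    · rw [mul_assoc, norm_mul, norm_mul, norm_pow]
      gcongr
      exact (mul_le_of_le_one_left (norm_nonneg _) (pow_le_one₀ (norm_nonneg _) htn)).trans hxa.le
  have hxab : ‖a‖ * ‖x‖ ≤ ‖b‖ := by
    have hap : ‖(p : PadicAlgCl p)‖ * ‖a‖ ^ p = ‖b‖ ^ p := by rw [norm_pow_p_eq hb, habn]
    refine le_of_pow_le_pow_left₀ hprime.ne_zero hb0.le ?_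
    rw [mul_pow, ← norm_pow x, ← hap]
    calc ‖a‖ ^ p * ‖x ^ p‖ ≤ ‖a‖ ^ p * (‖(p : PadicAlgCl p)‖ * ‖a‖) := by gcongr
      _ ≤ ‖a‖ ^ p * (‖(p : PadicAlgCl p)‖ * 1) := by gcongr
      _ = _ := by ring
  rw [show x ^ p + p * x + p * a = (ζ ^ p - t ^ p + p * a) -
      (ζ ^ p - t ^ p - x ^ p - p * t ^ (p - 1) * x) - p * ((t ^ (p - 1) - 1) * x) by ring]
  refine norm_sub_le_of_le_of_le (norm_sub_le_of_le_of_le hζp (hexp.trans ?_)) ?_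
  · gcongr
    rw [sq]
    exact (mul_le_mul_of_nonneg_right hxa.le (norm_nonneg _)).trans hxab
  · rw [norm_mul, norm_mul]
    gcongr
    exact (mul_le_mul_of_nonneg_right htp (norm_nonneg _)).trans hxab

/-- If `y^p + py + ps` is small, then `y^p` and `ps` have the same norm. -/
theorem norm_pow_eq_of_error_equation (hp : 3 ≤ p) (hb : b ^ (p - 1) = -p)
    {y s : PadicAlgCl p} (hs : ‖b‖ < ‖s‖)
    (h : ‖y ^ p + p * y + p * s‖ ≤ ‖(p : PadicAlgCl p)‖ * ‖b‖) :
    ‖y‖ ^ p = ‖(p : PadicAlgCl p)‖ * ‖s‖ := by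
  have hprime : p.Prime := Fact.out
  have hp0 := norm_p_pos (p := p)
  have h1 : ‖(y ^ p + p * y) - (-(p * s))‖ < ‖-((p : PadicAlgCl p) * s)‖ := by
    rw [sub_neg_eq_add, norm_neg, norm_mul]
    exact h.trans_lt (by gcongr)
  have h2 := norm_eq_of_norm_sub_lt h1
  rw [norm_neg, norm_mul] at h2
  -- If `|y| ≤ |b|`, both `y^p` and `py` have norm at most `|p||b|`, too small to balance `ps`.
  -- Above `|b|`, `y^p` dominates `py`.
  have hyb : ‖b‖ < ‖y‖ := by
    by_contra! hyb
    refine absurd (h2.symm.le.trans (norm_add_le_of_le_of_le (C := ‖(p : PadicAlgCl p)‖ * ‖b‖)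
      ?_ ?_)) (not_le.mpr (by gcongr))
    · rw [norm_pow, ← norm_pow_p_eq hb]; gcongr
    · rw [norm_mul]; gcongr
  have h3 : ‖(y ^ p + p * y) - y ^ p‖ < ‖y ^ p‖ := by
    rw [add_sub_cancel_left, norm_mul, norm_pow, ← norm_pow_sub_one_of_pow_eq hb,
      ← pow_sub_one_mul hprime.ne_zero ‖y‖]
    have := (norm_nonneg b).trans_lt hyb
    gcongr
    omega
  rw [← norm_pow, ← norm_eq_of_norm_sub_lt h3, h2]

/-- Successive approximation: each remainder `y` satisfies `y^p + py + p s_m ≈ 0`, and `s_{m+1}`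
solves the leading part `y^p = -p s_m`. -/
theorem norm_error_sub_sum (hp : 3 ≤ p) (hab : a ^ p = b) (hb : b ^ (p - 1) = -p)
    (hζ : ζ ^ (p ^ 2) = 1) (hζa : ‖ζ - 1 - a‖ < ‖a‖) {s : ℕ → PadicAlgCl p}
    (hs1 : s 1 = a) (hs : ∀ l, 1 ≤ l → s (l + 1) ^ p = -(p * s l)) (m : ℕ) (hm : 1 ≤ m) :
    ‖b‖ < ‖s m‖ ∧ ‖ζ - truncExp a - ∑ l ∈ Finset.Icc 2 m, s l‖ = ‖s (m + 1)‖ := by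
  have hprime : p.Prime := Fact.out
  have ha1 := norm_root_lt_one hab hb
  have hb1 := norm_lt_one_of_pow_eq hb
  have hb0 := norm_pos_of_pow_eq hp hb
  have hp0 := norm_p_pos (p := p)
  have hsn : ∀ l, 1 ≤ l → ‖s (l + 1)‖ ^ p = ‖(p : PadicAlgCl p)‖ * ‖s l‖ := fun l hl => by
    rw [← norm_pow, hs l hl, norm_neg, norm_mul]
  -- `|b|` is a fixed point of the recursion `|s_{l+1}|^p = |p||s_l|`, so the norms stay above it.
  have hbnd : ∀ l, 1 ≤ l → ‖b‖ < ‖s l‖ ∧ ‖s l‖ ≤ 1 := by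
    intro l hl
    induction l, hl using Nat.le_induction with
    | base =>
      rw [hs1, ← hab, norm_pow]
      refine ⟨pow_lt_self_of_lt_one₀ ?_ ha1 hprime.one_lt, ha1.le⟩
      exact (norm_nonneg _).trans_lt hζa
    | succ l hl ih =>
      constructor
      · refine lt_of_pow_lt_pow_left₀ p (norm_nonneg _) ?_
        rw [hsn l hl, norm_pow_p_eq hb]
        gcongr
        exact ih.1
      · rw [← pow_le_one_iff_of_nonneg (norm_nonneg _) hprime.ne_zero, hsn l hl]
        exact mul_le_one₀ norm_p_lt_one.le (norm_nonneg _) ih.2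
  have hsq : ∀ l, 1 ≤ l → ‖s (l + 1)‖ * ‖s (l + 1)‖ ≤ ‖b‖ := by
    intro l hl
    refine le_of_pow_le_pow_left₀ hprime.ne_zero hb0.le ?_
    rw [mul_pow, hsn l hl, norm_pow_p_eq hb]
    have h1 := (hbnd l hl).2
    calc ‖(p : PadicAlgCl p)‖ * ‖s l‖ * (‖(p : PadicAlgCl p)‖ * ‖s l‖)
        ≤ ‖(p : PadicAlgCl p)‖ * 1 * (‖(p : PadicAlgCl p)‖ * 1) := by gcongr
      _ ≤ ‖(p : PadicAlgCl p)‖ * ‖b‖ := by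
        rw [mul_one]
        gcongr
        exact norm_p_le hp hb
  have key : ‖(ζ - truncExp a - ∑ l ∈ Finset.Icc 2 m, s l) ^ p +
      p * (ζ - truncExp a - ∑ l ∈ Finset.Icc 2 m, s l) + p * s m‖ ≤
      ‖(p : PadicAlgCl p)‖ * ‖b‖ := by
    induction m, hm using Nat.le_induction with
    | base =>
      rw [Finset.Icc_eq_empty (by norm_num), Finset.sum_empty, sub_zero, hs1]
      exact norm_error_equation hp hab hb hζ hζa rfl
    | succ m hm ih =>
      rw [Finset.sum_Icc_succ_top (by omega)]
      set y := ζ - truncExp a - ∑ l ∈ Finset.Icc 2 m, s l with hy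
      have hyn : ‖y‖ = ‖s (m + 1)‖ := by
        refine (pow_left_inj₀ (norm_nonneg _) (norm_nonneg _) hprime.ne_zero).mp ?_
        rw [norm_pow_eq_of_error_equation hp hb (hbnd m hm).1 ih, hsn m hm]
      have hs1' := (hbnd (m + 1) (by omega)).2
      set w := y - s (m + 1) with hw
      have hwn : ‖w‖ ≤ ‖s (m + 1)‖ := norm_sub_le_of_le_of_le hyn.le le_rfl
      have h1 := norm_add_pow_sub_le hprime (hwn.trans hs1') hs1'
      rw [show w + s (m + 1) = y by rw [hw]; ring] at h1
      rw [show ζ - truncExp a - (∑ l ∈ Finset.Icc 2 m, s l + s (m + 1)) = w by rw [hw, hy]; ring]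
      -- Removing `s_{m+1}` absorbs `p s_m` into the `p`-th power and leaves `p s_{m+1}` from the
      -- linear term. The new error is only the cross terms, at most `|p||s_{m+1}|² ≤ |p||b|`.
      rw [show w ^ p + p * w + p * s (m + 1) = (y ^ p + p * y + p * s m) -
        (y ^ p - w ^ p - s (m + 1) ^ p) by rw [hs m hm, hw]; ring]
      refine norm_sub_le_of_le_of_le ih (h1.trans ?_)
      gcongr
      exact (mul_le_mul_of_nonneg_right hwn (norm_nonneg _)).trans (hsq m hm)
  refine ⟨(hbnd m hm).1, (pow_left_inj₀ (norm_nonneg _) (norm_nonneg _) hprime.ne_zero).mp ?_⟩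
  rw [norm_pow_eq_of_error_equation hp hb (hbnd m hm).1 key, hsn m hm]

end Expansion

/-! ### Teichmüller representatives modulo `p`. -/

section Teichmuller

/-- The Teichmüller representative of the class of `n` is congruent to `n` modulo `p`. -/
theorem norm_teich_natCast_sub_le (n : ℕ) :
    ‖teich ((n : ℕ) : ZMod p) - (n : PadicAlgCl p)‖ ≤ ‖(p : PadicAlgCl p)‖ := by
  set τ : ℤ_[p] := WittVector.equiv p (WittVector.teichmuller p (n : ZMod p)) with hτ
  -- Reduction through Witt vectors. Its kernel is a proper ideal, hence lies in `pℤ_p`.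
  let g : ℤ_[p] →+* ZMod p :=
    (WittVector.constantCoeff (p := p)).comp (WittVector.equiv p).symm.toRingHom
  have hg : g (τ - n) = 0 := by
    have h1 : g τ = n := by
      change (WittVector.constantCoeff (p := p)) ((WittVector.equiv p).symm τ) = n
      rw [hτ, RingEquiv.symm_apply_apply]
      exact WittVector.teichmuller_coeff_zero p _
    rw [map_sub, h1, map_natCast, sub_self]
  have hmem : τ - n ∈ IsLocalRing.maximalIdeal ℤ_[p] :=
    IsLocalRing.le_maximalIdeal (RingHom.ker_ne_top g) ((RingHom.mem_ker).mpr hg)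
  rw [PadicInt.maximalIdeal_eq_span_p, Ideal.mem_span_singleton] at hmem
  have h := norm_intEmb_le_of_dvd hmem
  rwa [map_sub, map_natCast, map_natCast] at h

theorem norm_inv_teich_factorial_sub_le {k : ℕ} (hk : k < p) :
    ‖1 / teich ((k ! : ℕ) : ZMod p) - ((k ! : ℕ) : PadicAlgCl p)⁻¹‖ ≤
      ‖(p : PadicAlgCl p)‖ := by
  have h1 := norm_factorial hk
  have h2 := norm_teich_natCast_sub_le (p := p) (k !)
  have h3 : ‖teich ((k ! : ℕ) : ZMod p)‖ = 1 := by
    rw [norm_eq_of_norm_sub_lt (h2.trans_lt (norm_p_lt_one.trans_eq h1.symm)), h1]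
  have h4 : teich ((k ! : ℕ) : ZMod p) ≠ 0 := norm_ne_zero_iff.mp (by rw [h3]; norm_num)
  have h5 : ((k ! : ℕ) : PadicAlgCl p) ≠ 0 := norm_ne_zero_iff.mp (by rw [h1]; norm_num)
  rw [one_div, inv_sub_inv h4 h5, norm_div, norm_mul, h1, h3, mul_one, div_one, norm_sub_rev]
  exact h2

end Teichmuller

/-! ### Norms of the rational powers of `p`. -/

section Powers

variable {P : AddChar ℚ (PadicAlgCl p)}

theorem addChar_ne_zero (x : ℚ) : P x ≠ 0 := by
  intro h
  have h1 := P.map_add_eq_mul x (-x)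
  rw [add_neg_cancel, P.map_zero_eq_one, h, zero_mul] at h1
  exact one_ne_zero h1

theorem addChar_pow (x : ℚ) (n : ℕ) : P x ^ n = P (n * x) := by
  rw [← AddChar.map_nsmul_eq_pow, nsmul_eq_mul]

theorem norm_addChar (hP : P 1 = p) (x : ℚ) : ‖P x‖ = (p : ℝ) ^ (-(x : ℝ)) := by
  have hp0 : (0 : ℝ) < p := by exact_mod_cast (Fact.out : p.Prime).pos
  have hd : x.den ≠ 0 := x.den_nz
  refine (pow_left_inj₀ (norm_nonneg _) (by positivity) hd).mp ?_
  rw [← norm_pow, addChar_pow, ← Real.rpow_mul_natCast hp0.le, Rat.den_mul_eq_num]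
  have h1 : P (x.num : ℚ) = (p : PadicAlgCl p) ^ x.num := by
    rw [← hP, ← AddChar.map_zsmul_eq_zpow, zsmul_eq_mul, mul_one]
  have h2 : (x : ℝ) * (x.den : ℝ) = (x.num : ℝ) := by exact_mod_cast Rat.mul_den_eq_num x
  rw [h1, norm_zpow, norm_p_eq, neg_mul, h2, Real.rpow_neg hp0.le, Real.rpow_intCast, inv_zpow]

end Powers

/-! ### A criterion for uniformizers by degree and norm. -/

section Uniformizer

theorem norm_algebraMap_eq_zpow {c : ℚ_[p]} (hc : c ≠ 0) :
    ‖algebraMap ℚ_[p] (PadicAlgCl p) c‖ = ‖(p : PadicAlgCl p)‖ ^ c.valuation := by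
  rw [PadicAlgCl.norm_extends, Padic.norm_eq_zpow_neg_valuation hc, norm_p_eq, inv_zpow, zpow_neg]

/-- Terms of a `ℚ_p`-combination of `1, π, …, π^(N-1)` have different norms if
`‖π‖^N = ‖p‖`. -/
theorem exists_norm_sum_eq_zpow {N : ℕ} {π : PadicAlgCl p}
    (hπ : ‖π‖ ^ N = ‖(p : PadicAlgCl p)‖) (c : Fin N → ℚ_[p]) (hc : c ≠ 0) :
    ∃ k : ℤ, ‖∑ i, algebraMap ℚ_[p] (PadicAlgCl p) (c i) * π ^ (i : ℕ)‖ = ‖π‖ ^ k := by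
  classical
  have hN : N ≠ 0 := by
    rintro rfl
    exact hc (Subsingleton.elim _ _)
  have hπ1 : ‖π‖ < 1 := by
    by_contra! h
    exact absurd (hπ ▸ one_le_pow₀ h) (not_le.mpr norm_p_lt_one)
  have hπ0 : 0 < ‖π‖ := by
    refine (norm_nonneg π).lt_of_ne fun h => ?_
    rw [← h, zero_pow hN] at hπ
    exact norm_p_pos.ne hπ
  set f : Fin N → PadicAlgCl p := fun i => algebraMap ℚ_[p] (PadicAlgCl p) (c i) * π ^ (i : ℕ)
  have hf : ∀ i, c i ≠ 0 → ‖f i‖ = ‖π‖ ^ ((N : ℤ) * (c i).valuation + (i : ℕ)) := by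
    intro i hi
    rw [norm_mul, norm_algebraMap_eq_zpow hi, ← hπ, norm_pow, zpow_add₀ hπ0.ne', zpow_mul,
      zpow_natCast, zpow_natCast]
  let s : Finset (Fin N) := Finset.univ.filter fun i => c i ≠ 0
  have hsne : s.Nonempty := by
    obtain ⟨i, hi⟩ := Function.ne_iff.mp hc
    exact ⟨i, by simpa [s] using hi⟩
  have hsum : ∑ i, f i = ∑ i ∈ s, f i := by
    refine (Finset.sum_subset (Finset.subset_univ s) fun i _ hi => ?_).symm
    have : c i = 0 := by simpa [s] using hi
    simp [f, this]
  have hpair : Set.Pairwise (s : Set (Fin N)) fun i j => ‖f i‖ ≠ ‖f j‖ := by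
    intro i hi j hj hij h
    have hi' : c i ≠ 0 := by simpa [s] using hi
    have hj' : c j ≠ 0 := by simpa [s] using hj
    rw [hf i hi', hf j hj'] at h
    -- Equal norms force equal exponents of `‖π‖`; modulo `N` these are the indices `i` and `j`.
    have h1 := congrArg (· % (N : ℤ)) (zpow_right_injective₀ hπ0 hπ1.ne h)
    simp only [Int.mul_add_emod_self_left] at h1
    rw [Int.emod_eq_of_lt (by positivity) (by exact_mod_cast i.2),
      Int.emod_eq_of_lt (by positivity) (by exact_mod_cast j.2)] at h1
    exact hij (Fin.ext (by exact_mod_cast h1))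
  obtain ⟨i, hi, hi'⟩ := Finset.exists_mem_eq_sup' hsne fun i => ‖f i‖
  refine ⟨(N : ℤ) * (c i).valuation + (i : ℕ), ?_⟩
  rw [hsum, IsUltrametricDist.norm_sum_eq_sup'_of_pairwise_ne hsne hpair, hi',
    hf i (by simpa [s] using hi)]

/-- In an extension of degree at most `N`, an element `π` with `‖π‖^N = ‖p‖` is a uniformizer
(and the extension is totally ramified). -/
theorem isUniformizerOf_of_finrank_le {K : IntermediateField ℚ_[p] (PadicAlgCl p)}
    [FiniteDimensional ℚ_[p] K] {N : ℕ} (hK : Module.finrank ℚ_[p] K ≤ N) {π : PadicAlgCl p}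
    (hπK : π ∈ K) (hπ : ‖π‖ ^ N = ‖(p : PadicAlgCl p)‖) : IsUniformizerOf K π := by
  have hN : N ≠ 0 := by
    have := Module.finrank_pos (R := ℚ_[p]) (M := K)
    omega
  have hπ1 : ‖π‖ < 1 := by
    by_contra! h
    exact absurd (hπ ▸ one_le_pow₀ h) (not_le.mpr norm_p_lt_one)
  have hπ0 : π ≠ 0 := by
    rintro rfl
    rw [norm_zero, zero_pow hN] at hπ
    exact norm_p_pos.ne hπ
  let w : Fin N → K := fun i => (⟨π, hπK⟩ : K) ^ (i : ℕ)
  have hw : ∀ c : Fin N → ℚ_[p], ((∑ i, c i • w i : K) : PadicAlgCl p) =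
      ∑ i, algebraMap ℚ_[p] (PadicAlgCl p) (c i) * π ^ (i : ℕ) := by
    intro c
    rw [← IntermediateField.algebraMap_apply, map_sum]
    refine Finset.sum_congr rfl fun i _ => ?_
    rw [Algebra.smul_def, map_mul, map_pow]
    rfl
  have hli : LinearIndependent ℚ_[p] w := by
    rw [Fintype.linearIndependent_iff]
    intro c hc
    by_contra! hne
    obtain ⟨i, hi⟩ := hne
    obtain ⟨k, hk⟩ := exists_norm_sum_eq_zpow hπ c (fun h => hi (congrFun h i))
    rw [← hw, hc, ZeroMemClass.coe_zero, norm_zero] at hk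
    exact (zpow_pos (norm_pos_iff.mpr hπ0) k).ne hk
  -- Independence gives degree at least `N`, so the assumed upper bound is an equality and the
  -- powers form a basis.
  have hspan : Submodule.span ℚ_[p] (Set.range w) = ⊤ := by
    refine hli.span_eq_top_of_card_eq_finrank' (le_antisymm hli.fintype_card_le_finrank ?_)
    rwa [Fintype.card_fin]
  have hval : ∀ x : K, x ≠ 0 → ∃ k : ℤ, ‖(x : PadicAlgCl p)‖ = ‖π‖ ^ k := by
    intro x hx
    obtain ⟨c, rfl⟩ := (Submodule.mem_span_range_iff_exists_fun ℚ_[p]).mp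
      (hspan ▸ Submodule.mem_top : x ∈ Submodule.span ℚ_[p] (Set.range w))
    obtain ⟨k, hk⟩ := exists_norm_sum_eq_zpow hπ c (by rintro rfl; simp at hx)
    exact ⟨k, by rw [hw, hk]⟩
  have hv : ∀ x : K, valuationOn K x = ‖(x : PadicAlgCl p)‖₊ := fun x => rfl
  have hγ0 : ‖π‖₊ ≠ 0 := nnnorm_ne_zero_iff.mpr hπ0
  let γ : ℝ≥0ˣ := Units.mk0 ‖π‖₊ hγ0
  have hγ1 : γ < 1 := by
    rw [← Units.val_lt_val]
    exact hπ1
  have hγ : Subgroup.zpowers γ = MonoidWithZeroHom.valueGroup (.ofClass (valuationOn K)) := by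
    ext y
    rw [Subgroup.mem_zpowers_iff, MonoidWithZeroHom.mem_valueGroup_iff_of_comm']
    constructor
    · rintro ⟨k, rfl⟩
      refine ⟨1, by simp, (⟨π, hπK⟩ : K) ^ k, ?_, ?_⟩
      · simp [hv, hπ0, zpow_ne_zero]
      · simp [hv, γ]
    · rintro ⟨a, ha, x, hx, hax⟩
      have ha0 : a ≠ 0 := by rintro rfl; simp at ha
      have hx0 : x ≠ 0 := by rintro rfl; simp at hx
      obtain ⟨k, hk⟩ := hval (x / a) (div_ne_zero hx0 ha0)
      refine ⟨k, Units.ext ?_⟩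
      have h1 : (y : ℝ≥0) = valuationOn K (x / a) := by
        rw [map_div₀]
        exact eq_div_of_mul_eq ha ((mul_comm _ _).trans hax)
      rw [h1, hv, Units.val_zpow_eq_zpow_val]
      exact NNReal.eq (by simpa [γ] using hk.symm)
  have hdisc : (valuationOn K).IsRankOneDiscrete := ⟨γ, hγ, hγ1⟩
  refine ⟨hdisc, hπK, ?_⟩
  have h1 : Valuation.IsRankOneDiscrete.generator (valuationOn K) = γ := by
    rw [← Valuation.IsRankOneDiscrete.valueGroup_genLTOne_eq_generator]
    exact (LinearOrderedCommGroup.Subgroup.genLTOne_unique _ hγ1 hγ).symm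
  rw [Valuation.IsUniformizer.iff, h1]
  rfl

end Uniformizer

/-! ### Krasner's lemma and the degree of `K_{2,m}`. -/

section Field

/-- A root of unity `u` of order prime to `p` with `‖u - 1‖ < 1` is trivial. -/
theorem eq_one_of_pow_eq_one_of_norm_sub_lt {n : ℕ} (hn : ‖(n : PadicAlgCl p)‖ = 1)
    {u : PadicAlgCl p} (hu : u ^ n = 1) (hu1 : ‖u - 1‖ < 1) : u = 1 := by
  by_contra h
  have hmul : (u - 1) * ∑ i ∈ Finset.range n, u ^ i = 0 := by rw [mul_geom_sum, hu, sub_self]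
  have h0 := (mul_eq_zero.mp hmul).resolve_left (sub_ne_zero.mpr h)
  have hun : ‖u‖ ≤ 1 := by
    rw [← sub_add_cancel u 1]
    exact norm_add_le_of_le_of_le hu1.le (by simp)
  have h1 : ‖∑ i ∈ Finset.range n, u ^ i - (n : PadicAlgCl p)‖ ≤ ‖u - 1‖ := by
    have h2 : ∑ i ∈ Finset.range n, u ^ i - (n : PadicAlgCl p) =
        ∑ i ∈ Finset.range n, (u ^ i - 1) := by simp
    rw [h2]
    refine IsUltrametricDist.norm_sum_le_of_forall_le_of_nonneg (norm_nonneg _) fun i _ => ?_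
    rw [← mul_geom_sum, norm_mul]
    refine mul_le_of_le_one_right (norm_nonneg _) ?_
    refine IsUltrametricDist.norm_sum_le_of_forall_le_of_nonneg zero_le_one fun j _ => ?_
    rw [norm_pow]
    exact pow_le_one₀ (norm_nonneg _) hun
  rw [h0, zero_sub, norm_neg, hn] at h1
  exact absurd hu1 (not_lt.mpr h1)

/-- Krasner's lemma for a Kummer generator of degree prime to `p`. -/
theorem mem_of_pow_mem_of_norm_sub_lt {K : IntermediateField ℚ_[p] (PadicAlgCl p)} {n : ℕ}
    (hn : ‖(n : PadicAlgCl p)‖ = 1) {x y : PadicAlgCl p} (hx : x ^ n ∈ K) (hy : y ∈ K)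
    (hxy : ‖y - x‖ < ‖x‖) : x ∈ K := by
  have hx0 : x ≠ 0 := norm_pos_iff.mp ((norm_nonneg _).trans_lt hxy)
  rw [← InfiniteGalois.fixedField_fixingSubgroup K, IntermediateField.mem_fixedField_iff]
  intro σ hσ
  rw [IntermediateField.mem_fixingSubgroup_iff] at hσ
  -- Automorphisms are isometries, so `y` is as close to `σ x` as to `x`. Then `σ x / x` is an
  -- `n`-th root of unity close to `1`.
  have hiso : ∀ w, ‖σ w‖ = ‖w‖ := fun w => (spectralNorm_eq_of_equiv σ w).symm
  have h1 : ‖y - σ x‖ < ‖x‖ := by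
    have h := hiso (y - x)
    rw [map_sub, hσ y hy] at h
    rwa [h]
  have h2 : ‖σ x - x‖ < ‖x‖ := by
    rw [show σ x - x = (y - x) - (y - σ x) by ring]
    exact norm_sub_lt_of_lt_of_lt hxy h1
  have h3 : σ x / x = 1 := by
    refine eq_one_of_pow_eq_one_of_norm_sub_lt hn ?_ ?_
    · rw [div_pow, ← map_pow, hσ _ hx, div_self (pow_ne_zero _ hx0)]
    · rw [div_sub_one hx0, norm_div, div_lt_one (norm_pos_iff.mpr hx0)]
      exact h2
  exact (div_eq_one_iff_eq hx0).mp h3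

theorem finrank_adjoin_simple_le {x : PadicAlgCl p} {f : Polynomial ℚ_[p]} (hf : f ≠ 0)
    (hx : Polynomial.aeval x f = 0) :
    Module.finrank ℚ_[p] (IntermediateField.adjoin ℚ_[p] {x}) ≤ f.natDegree := by
  rw [IntermediateField.adjoin.finrank (Algebra.IsIntegral.isIntegral x)]
  exact Polynomial.natDegree_le_of_dvd (minpoly.dvd _ _ hx) hf

variable {P : AddChar ℚ (PadicAlgCl p)} {ζ : PadicAlgCl p}

theorem K2_eq_sup (m : ℕ) : K2 P ζ m = IntermediateField.adjoin ℚ_[p] {ζ} ⊔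
    IntermediateField.adjoin ℚ_[p] {P (1 / (p : ℚ) ^ m)} := by
  rw [K2, ← Set.singleton_union, IntermediateField.adjoin_union]

instance finiteDimensional_K2 (m : ℕ) : FiniteDimensional ℚ_[p] (K2 P ζ m) := by
  rw [K2_eq_sup]
  have h : ∀ x : PadicAlgCl p,
      FiniteDimensional ℚ_[p] (IntermediateField.adjoin ℚ_[p] {x}) := fun x =>
    IntermediateField.adjoin.finiteDimensional (Algebra.IsIntegral.isIntegral x)
  have := h ζ
  have := h (P (1 / (p : ℚ) ^ m))
  exact IntermediateField.finiteDimensional_sup _ _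

theorem finrank_K2_le (hP : P 1 = p) (hζ : IsPrimitiveRoot ζ (p ^ 2)) (m : ℕ) :
    Module.finrank ℚ_[p] (K2 P ζ m) ≤ p ^ (m + 1) * (p - 1) := by
  have hprime : p.Prime := Fact.out
  rw [K2_eq_sup]
  refine (IntermediateField.finrank_sup_le _ _).trans ?_
  have h1 : Module.finrank ℚ_[p] (IntermediateField.adjoin ℚ_[p] {ζ}) ≤ p * (p - 1) := by
    refine (finrank_adjoin_simple_le (Polynomial.cyclotomic_ne_zero (p ^ 2) ℚ_[p]) ?_).trans ?_
    · have h := hζ.isRoot_cyclotomic (pow_pos hprime.pos 2)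
      rwa [Polynomial.IsRoot.def, ← Polynomial.map_cyclotomic (p ^ 2) (algebraMap ℚ_[p] _),
        Polynomial.eval_map_algebraMap] at h
    · rw [Polynomial.natDegree_cyclotomic, Nat.totient_prime_pow hprime two_pos]
      simp
  have h2 : Module.finrank ℚ_[p] (IntermediateField.adjoin ℚ_[p] {P (1 / (p : ℚ) ^ m)}) ≤
      p ^ m := by
    have hpm : p ^ m ≠ 0 := pow_ne_zero _ hprime.ne_zero
    refine (finrank_adjoin_simple_le
      (Polynomial.X_pow_sub_C_ne_zero (Nat.pos_of_ne_zero hpm) (p : ℚ_[p])) ?_).trans ?_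
    · have hpq : (p : ℚ) ≠ 0 := by exact_mod_cast hprime.ne_zero
      rw [map_sub, map_pow, Polynomial.aeval_X, Polynomial.aeval_C, map_natCast, addChar_pow,
        Nat.cast_pow, mul_one_div_cancel (pow_ne_zero _ hpq), hP, sub_self]
    · rw [Polynomial.natDegree_X_pow_sub_C]
  calc _ ≤ p * (p - 1) * p ^ m := Nat.mul_le_mul h1 h2
    _ = _ := by ring

end Field

/-! ### The elements `π_{2,m}`: norm, membership, uniformizer property. -/

section Main

variable {P : AddChar ℚ (PadicAlgCl p)} {ζ z : PadicAlgCl p}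

theorem cast_p_ne_zero : (p : ℚ) ≠ 0 := by exact_mod_cast (Fact.out : p.Prime).ne_zero

theorem cast_p_sub_one_ne_zero : (p : ℚ) - 1 ≠ 0 :=
  sub_ne_zero.mpr (by exact_mod_cast (Fact.out : p.Prime).ne_one)

theorem pow_sub_one_eq_neg_one (hp : 3 ≤ p) (hz : IsPrimitiveRoot z (2 * (p - 1))) :
    z ^ (p - 1) = -1 := by
  have h : (z ^ (p - 1)) ^ 2 = 1 := by rw [← pow_mul, mul_comm, hz.pow_eq_one]
  exact (sq_eq_sq_iff_eq_or_eq_neg.mp (h.trans (one_pow 2).symm)).resolve_left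
    (hz.pow_ne_one_of_pos_of_lt (by omega) (by omega))

theorem pow_p_eq_neg (hp : 3 ≤ p) (hz : IsPrimitiveRoot z (2 * (p - 1))) : z ^ p = -z := by
  rw [← pow_sub_one_mul (Fact.out : p.Prime).ne_zero, pow_sub_one_eq_neg_one hp hz, neg_one_mul]

theorem norm_z_eq_one (hp : 3 ≤ p) (hz : IsPrimitiveRoot z (2 * (p - 1))) : ‖z‖ = 1 := by
  rw [← pow_eq_one_iff_of_nonneg (norm_nonneg z) (n := p - 1) (by omega), ← norm_pow,
    pow_sub_one_eq_neg_one hp hz, norm_neg, norm_one]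

/-- The `(p-1)`-st root `-z p^{1/(p-1)}` of `-p`. -/
def dworkPi (P : AddChar ℚ (PadicAlgCl p)) (z : PadicAlgCl p) : PadicAlgCl p :=
  -(z * P (1 / ((p : ℚ) - 1)))

/-- The terms `z p^{1/(p-1) - 1/p^l}` of the expansion of `ζ_{p²}`. -/
def tailTerm (P : AddChar ℚ (PadicAlgCl p)) (z : PadicAlgCl p) (l : ℕ) : PadicAlgCl p :=
  z * P (1 / ((p : ℚ) - 1) - 1 / (p : ℚ) ^ l)

theorem tailTerm_one : tailTerm P z 1 = z * P (1 / ((p : ℚ) * ((p : ℚ) - 1))) := by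
  have h1 := cast_p_ne_zero (p := p)
  have h2 := cast_p_sub_one_ne_zero (p := p)
  rw [tailTerm]
  congr 2
  field_simp
  ring

theorem dworkPi_pow (hp : 3 ≤ p) (hP : P 1 = p) (hz : IsPrimitiveRoot z (2 * (p - 1))) :
    dworkPi P z ^ (p - 1) = -p := by
  have hprime : p.Prime := Fact.out
  have heven : Even (p - 1) := hprime.even_sub_one (by omega)
  have h : ((p - 1 : ℕ) : ℚ) = (p : ℚ) - 1 := by rw [Nat.cast_sub hprime.one_le, Nat.cast_one]
  rw [dworkPi, heven.neg_pow, mul_pow, pow_sub_one_eq_neg_one hp hz, addChar_pow, h,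
    mul_one_div_cancel cast_p_sub_one_ne_zero, hP, neg_one_mul]

theorem tailTerm_one_pow (hp : 3 ≤ p) (hz : IsPrimitiveRoot z (2 * (p - 1))) :
    tailTerm P z 1 ^ p = dworkPi P z := by
  have h1 := cast_p_ne_zero (p := p)
  have h2 := cast_p_sub_one_ne_zero (p := p)
  rw [tailTerm_one, mul_pow, pow_p_eq_neg hp hz, addChar_pow, dworkPi, neg_mul]
  congr 3
  field_simp

theorem tailTerm_succ_pow (hp : 3 ≤ p) (hP : P 1 = p) (hz : IsPrimitiveRoot z (2 * (p - 1)))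
    (l : ℕ) : tailTerm P z (l + 1) ^ p = -(p * tailTerm P z l) := by
  have h1 := cast_p_ne_zero (p := p)
  have h2 := cast_p_sub_one_ne_zero (p := p)
  rw [tailTerm, tailTerm, mul_pow, pow_p_eq_neg hp hz, addChar_pow]
  have h : (p : ℚ) * (1 / ((p : ℚ) - 1) - 1 / (p : ℚ) ^ (l + 1)) =
      1 + (1 / ((p : ℚ) - 1) - 1 / (p : ℚ) ^ l) := by
    rw [pow_succ]
    field_simp
    ring
  rw [h, AddChar.map_add_eq_mul, hP]
  ring

theorem norm_tailTerm (hp : 3 ≤ p) (hP : P 1 = p) (hz : IsPrimitiveRoot z (2 * (p - 1))) (l : ℕ) :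
    ‖tailTerm P z l‖ = (p : ℝ) ^ (-(1 / ((p : ℝ) - 1) - 1 / (p : ℝ) ^ l)) := by
  rw [tailTerm, norm_mul, norm_z_eq_one hp hz, one_mul, norm_addChar hP]
  push_cast
  rfl

theorem term_eq (k : ℕ) : z ^ k * P ((k : ℚ) / ((p : ℚ) * ((p : ℚ) - 1))) =
    tailTerm P z 1 ^ k := by
  rw [tailTerm_one, mul_pow, addChar_pow, mul_one_div]

theorem headSum_eq : headSum P z = ∑ k ∈ Finset.range p,
    1 / teich ((k ! : ℕ) : ZMod p) * tailTerm P z 1 ^ k := by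
  rw [headSum]
  exact Finset.sum_congr rfl fun k _ => by rw [mul_assoc, term_eq]

theorem norm_headSum_sub_truncExp_le (h : ‖tailTerm P z 1‖ ≤ 1) :
    ‖headSum P z - truncExp (tailTerm P z 1)‖ ≤ ‖(p : PadicAlgCl p)‖ := by
  rw [headSum_eq, truncExp, ← Finset.sum_sub_distrib]
  refine IsUltrametricDist.norm_sum_le_of_forall_le_of_nonneg (norm_nonneg _) fun k hk => ?_
  rw [← sub_mul, norm_mul, norm_pow]
  exact (mul_le_of_le_one_right (norm_nonneg _) (pow_le_one₀ (norm_nonneg _) h)).trans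
    (norm_inv_teich_factorial_sub_le (Finset.mem_range.mp hk))

theorem norm_sub_tailTerm_lt (hp : 3 ≤ p) (hz : IsPrimitiveRoot z (2 * (p - 1)))
    (hcompat : ‖ζ - (1 + z * P (1 / ((p : ℚ) * ((p : ℚ) - 1))))‖ <
      ‖P (1 / ((p : ℚ) * ((p : ℚ) - 1)))‖) :
    ‖ζ - 1 - tailTerm P z 1‖ < ‖tailTerm P z 1‖ := by
  rwa [sub_sub, tailTerm_one, norm_mul, norm_z_eq_one hp hz, one_mul]

/-- The expansion of `ζ_{p²}`: the first omitted term gives the norm of the remainder. -/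
theorem norm_sub_headSum_sub_sum (hp : 3 ≤ p) (hP : P 1 = p) (hζ : IsPrimitiveRoot ζ (p ^ 2))
    (hz : IsPrimitiveRoot z (2 * (p - 1)))
    (hζa : ‖ζ - 1 - tailTerm P z 1‖ < ‖tailTerm P z 1‖) {m : ℕ} (hm : 1 ≤ m) :
    ‖ζ - headSum P z - ∑ l ∈ Finset.Icc 2 m, tailTerm P z l‖ = ‖tailTerm P z (m + 1)‖ := by
  have hb := dworkPi_pow hp hP hz
  have hab := tailTerm_one_pow (P := P) hp hz
  have key := fun m hm => norm_error_sub_sum hp hab hb hζ.pow_eq_one hζa rfl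
    (fun l _ => tailTerm_succ_pow (P := P) hp hP hz l) m hm
  rw [← (key m hm).2]
  refine norm_eq_of_norm_sub_lt ?_
  rw [(key m hm).2]
  -- The Teichmüller correction has norm at most `|p| ≤ |b|`, and `|b| < |s_{m+1}|` is the first
  -- half of `key` at `m + 1`.
  refine lt_of_le_of_lt ?_ (key (m + 1) (by omega)).1
  rw [show ζ - headSum P z - ∑ l ∈ Finset.Icc 2 m, tailTerm P z l -
    (ζ - truncExp (tailTerm P z 1) - ∑ l ∈ Finset.Icc 2 m, tailTerm P z l) =
    -(headSum P z - truncExp (tailTerm P z 1)) by ring, norm_neg]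
  exact (norm_headSum_sub_truncExp_le (norm_root_lt_one hab hb).le).trans (norm_p_le hp hb)

theorem pi2_eq (m : ℕ) : pi2 P ζ z m = (P (1 / (p : ℚ) ^ m) ^ ((p ^ m - 1) / (p - 1)))⁻¹ *
    (ζ - headSum P z - ∑ l ∈ Finset.Icc 2 m, tailTerm P z l) := rfl

theorem pi21_eq_pi2 : pi21 P ζ z = pi2 P ζ z 1 := by
  have h : p - 1 ≠ 0 := Nat.sub_ne_zero_of_lt (Fact.out : p.Prime).one_lt
  rw [pi2_eq, pi21, pow_one, pow_one, Nat.div_self (Nat.pos_of_ne_zero h), pow_one,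
    Finset.Icc_eq_empty (by norm_num), Finset.sum_empty, sub_zero]

/-- The remainder has valuation `1/(p-1) - 1/p^(m+1)` and the normalizing power `1/(p-1) -
1/(p^m(p-1))`; subtract. -/
theorem norm_pi2 (hp : 3 ≤ p) (hP : P 1 = p) (hζ : IsPrimitiveRoot ζ (p ^ 2))
    (hz : IsPrimitiveRoot z (2 * (p - 1)))
    (hζa : ‖ζ - 1 - tailTerm P z 1‖ < ‖tailTerm P z 1‖) {m : ℕ} (hm : 1 ≤ m) :
    ‖pi2 P ζ z m‖ = (p : ℝ) ^ (-(1 / ((p : ℝ) ^ (m + 1) * ((p : ℝ) - 1)))) := by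
  have hprime : p.Prime := Fact.out
  have hp0 : (0 : ℝ) < p := by exact_mod_cast hprime.pos
  have hp1 : (p : ℝ) - 1 ≠ 0 := sub_ne_zero.mpr (by exact_mod_cast hprime.ne_one)
  have hdvd : p - 1 ∣ p ^ m - 1 := by simpa using Nat.sub_dvd_pow_sub_pow p 1 m
  have hcast : (((p ^ m - 1) / (p - 1) : ℕ) : ℝ) = ((p : ℝ) ^ m - 1) / ((p : ℝ) - 1) := by
    rw [Nat.cast_div hdvd (by rw [Nat.cast_sub hprime.one_le]; simpa using hp1),
      Nat.cast_sub (Nat.one_le_pow _ _ hprime.pos), Nat.cast_sub hprime.one_le]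
    push_cast
    rfl
  rw [pi2_eq, norm_mul, norm_inv, norm_pow, norm_sub_headSum_sub_sum hp hP hζ hz hζa hm,
    norm_tailTerm hp hP hz, norm_addChar hP, ← Real.rpow_mul_natCast hp0.le,
    ← Real.rpow_neg hp0.le, ← Real.rpow_add hp0, hcast]
  congr 1
  push_cast
  field_simp
  ring

theorem norm_natCast_p_sub_one (hp : 3 ≤ p) : ‖((p - 1 : ℕ) : PadicAlgCl p)‖ = 1 := by
  rw [Nat.cast_sub (by omega), Nat.cast_one]
  have h : ‖(p : PadicAlgCl p) - 1 - (-1)‖ < ‖(-1 : PadicAlgCl p)‖ := by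
    simpa using norm_p_lt_one (p := p)
  rw [norm_eq_of_norm_sub_lt h]
  simp

theorem tailTerm_mem_K2 (hp : 3 ≤ p) (hP : P 1 = p) (hz : IsPrimitiveRoot z (2 * (p - 1)))
    (hζa : ‖ζ - 1 - tailTerm P z 1‖ < ‖tailTerm P z 1‖) {m : ℕ} (hm : 1 ≤ m) {l : ℕ}
    (hl : l ≤ m) : tailTerm P z l ∈ K2 P ζ m := by
  have h1 := cast_p_ne_zero (p := p)
  have hPl : ∀ l ≤ m, P (1 / (p : ℚ) ^ l) ∈ K2 P ζ m := by
    intro l hl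
    have hmem : P (1 / (p : ℚ) ^ m) ∈ K2 P ζ m :=
      IntermediateField.subset_adjoin _ _ (by simp)
    have h : P (1 / (p : ℚ) ^ l) = P (1 / (p : ℚ) ^ m) ^ p ^ (m - l) := by
      rw [addChar_pow]
      congr 1
      push_cast
      rw [← Nat.sub_add_cancel hl, pow_add, Nat.add_sub_cancel]
      field_simp
    rw [h]
    exact pow_mem hmem _
  have hζmem : ζ ∈ K2 P ζ m := IntermediateField.subset_adjoin _ _ (by simp)
  have hterm : ∀ l, tailTerm P z l = -dworkPi P z / P (1 / (p : ℚ) ^ l) := by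
    intro l
    rw [eq_div_iff (addChar_ne_zero _), tailTerm, dworkPi, mul_assoc, ← AddChar.map_add_eq_mul,
      sub_add_cancel, neg_neg]
  -- Krasner with exponent `p - 1` and approximation `ζ - 1`: since `a = -b / p^{1/p}`, the power
  -- `a^(p-1)` is, up to sign, `p` divided by a power of `p^{1/p}`, which lies in the field.
  have hone : tailTerm P z 1 ∈ K2 P ζ m := by
    refine mem_of_pow_mem_of_norm_sub_lt (norm_natCast_p_sub_one hp) ?_
      (sub_mem hζmem (one_mem _)) hζa
    rw [hterm, div_pow, neg_pow, dworkPi_pow hp hP hz]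
    refine div_mem (mul_mem (pow_mem (neg_mem (one_mem _)) _) (neg_mem (natCast_mem _ p)))
      (pow_mem (hPl 1 hm) _)
  have hdwork : -dworkPi P z ∈ K2 P ζ m := by
    have h := mul_mem hone (hPl 1 hm)
    rwa [hterm, div_mul_cancel₀ _ (addChar_ne_zero _)] at h
  rw [hterm]
  exact div_mem hdwork (hPl l hl)

theorem pi2_mem_K2 (hp : 3 ≤ p) (hP : P 1 = p) (hz : IsPrimitiveRoot z (2 * (p - 1)))
    (hζa : ‖ζ - 1 - tailTerm P z 1‖ < ‖tailTerm P z 1‖) {m : ℕ} (hm : 1 ≤ m) :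
    pi2 P ζ z m ∈ K2 P ζ m := by
  have hterm := fun l (hl : l ≤ m) => tailTerm_mem_K2 hp hP hz hζa hm hl
  rw [pi2_eq, headSum_eq]
  refine mul_mem (inv_mem (pow_mem (IntermediateField.subset_adjoin _ _ (by simp)) _))
    (sub_mem (sub_mem (IntermediateField.subset_adjoin _ _ (by simp)) ?_) ?_)
  · exact sum_mem fun k _ => mul_mem
      (div_mem (one_mem _) (IntermediateField.algebraMap_mem _ _)) (pow_mem (hterm 1 hm) _)
  · exact sum_mem fun l hl => hterm l (Finset.mem_Icc.mp hl).2

theorem isUniformizerOf_pi2 (hp : 3 ≤ p) (hP : P 1 = p) (hζ : IsPrimitiveRoot ζ (p ^ 2))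
    (hz : IsPrimitiveRoot z (2 * (p - 1)))
    (hζa : ‖ζ - 1 - tailTerm P z 1‖ < ‖tailTerm P z 1‖) {m : ℕ} (hm : 1 ≤ m) :
    IsUniformizerOf (K2 P ζ m) (pi2 P ζ z m) := by
  have hprime : p.Prime := Fact.out
  have hp0 : (0 : ℝ) < p := by exact_mod_cast hprime.pos
  have hp1 : (p : ℝ) - 1 ≠ 0 := sub_ne_zero.mpr (by exact_mod_cast hprime.ne_one)
  refine isUniformizerOf_of_finrank_le (finrank_K2_le hP hζ m) (pi2_mem_K2 hp hP hz hζa hm) ?_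
  rw [norm_pi2 hp hP hζ hz hζa hm, norm_p_eq, ← Real.rpow_mul_natCast hp0.le, ← Real.rpow_neg_one]
  congr 1
  rw [Nat.cast_mul, Nat.cast_sub hprime.one_le]
  push_cast
  field_simp

end Main

end FalseTate

end

theorem theorem3p19 (p : ℕ) [Fact p.Prime] (hp : 3 ≤ p)
    -- a compatible system of rational powers of p: P x = p^x
    (P : AddChar ℚ (PadicAlgCl p)) (hP : P 1 = (p : PadicAlgCl p))
    (ζ z : PadicAlgCl p)
    (hζ : IsPrimitiveRoot ζ (p ^ 2)) (hz : IsPrimitiveRoot z (2 * (p - 1)))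
    -- compatible choices: ζ = 1 + z p^{1/(p(p-1))} + o(p^{1/(p(p-1))})
    (hcompat : ‖ζ - (1 + z * P (1 / ((p : ℚ) * ((p : ℚ) - 1))))‖ <
      ‖P (1 / ((p : ℚ) * ((p : ℚ) - 1)))‖) :
    (FalseTate.IsUniformizerOf (FalseTate.K2 P ζ 1) (FalseTate.pi21 P ζ z) ∧
      ‖FalseTate.pi21 P ζ z‖ = (p : ℝ) ^ (-(1 / ((p : ℝ) ^ 2 * ((p : ℝ) - 1))))) ∧
    (∀ m : ℕ, 2 ≤ m →
      FalseTate.IsUniformizerOf (FalseTate.K2 P ζ m) (FalseTate.pi2 P ζ z m) ∧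
      ‖FalseTate.pi2 P ζ z m‖ =
        (p : ℝ) ^ (-(1 / ((p : ℝ) ^ (m + 1) * ((p : ℝ) - 1))))) := by
  have hζa := FalseTate.norm_sub_tailTerm_lt hp hz hcompat
  rw [FalseTate.pi21_eq_pi2]
  exact ⟨⟨FalseTate.isUniformizerOf_pi2 hp hP hζ hz hζa le_rfl,
      FalseTate.norm_pi2 hp hP hζ hz hζa le_rfl⟩,
    fun m hm => ⟨FalseTate.isUniformizerOf_pi2 hp hP hζ hz hζa (by omega),
      FalseTate.norm_pi2 hp hP hζ hz hζa (by omega)⟩⟩
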